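/- **Setting.** A deep belief network (DBN) with $L\ge 2$ layers, each consisting of $n$ units with finite state spaces of cardinalities $q_1,\dots,q_n\ge 1$, is the following family of probability distributions on $\mathcal X=\prod_{i=1}^n\{1,\dots,q_i\}$. Write $h^1,\dots,h^L\in\mathcal X$ for the states of the layers, with $h^1$ visible and the others hidden. The deepest two layers form a restricted Boltzmann machine, $$p(h^{L-1},h^L)\propto\exp\Big(\sum_i b_i(h^{L-1}_i)+\sum_j c_j(h^L_j)+\sum_{i,j}W_{ij}(h^{L-1}_i,h^L_j)\Big),$$ and for $1\le l\le L-2$ the units of layer $l$ are conditionally independent given layer $l+1$, with $$p(h^l_i=a\mid h^{l+1})\propto\exp\Big(b^l_i(a)+\sum_jW^l_{ij}(a,h^{l+1}_j)\Big).$$ The model $\mathrm{DBN}$ is the set of all marginal distributions on $h^1$ of $p(h^{L-1},h^L)\prod_{l=1}^{L-2}p(h^l\mid h^{l+1})$, where all biases $b_i,c_j,b^l_i$ and interaction tables $W_{ij},W^l_{ij}$ range over arbitrary real-valued functions. Let $$D_{\mathrm{DBN}}=\sup_{p}\ \inf_{r\in\mathrm{DBN}}\ \sum_{x\in\mathcal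 X}p(x)\log\frac{p(x)}{r(x)},$$ where $p$ ranges over all probability distributions on $\mathcal X$. **Theorem.** Let $m$ be an integer with $\prod_{j=m+2}^{n}q_j\le m\le n$ (an empty product is $1$), and suppose that $q_1\ge\cdots\ge q_m\ge 2$. If $$L\ \ge\ 2+\frac{q_1^S-1}{q_1-1}\qquad\text{for some }S\in\{0,1,\dots,m\},$$ then $$D_{\mathrm{DBN}}\ \le\ \log\prod_{j=1}^{m-S}q_j .$$ In particular, let $k\ge 1$ be an integer. If all units are binary and the network has $L\ge 1+2^S$ layers of $n=2^{k-1}+k$ units, for some $S\in\{0,1,\dots,2^{k-1}\}$, then $$D_{\mathrm{DBN}}\ \le\ \big(2^{k-1}-S\big)\log 2 .$$ -/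

import Mathlib

noncomputable section

namespace DeepBelief

/-! ### Maximal information divergence from a model on a finite set -/

section Divergence

variable {X : Type*} [Fintype X]

open Classical in
/-- The Kullback-Leibler divergence `D(p‖r) = ∑ x, p x * log (p x / r x)`, with `0 log 0 = 0`,
and with value `⊤` if `r` vanishes at a point where `p` does not. -/
def klDivergence (p r : X → ℝ) : EReal :=
  if ∀ x, r x = 0 → p x = 0 then ((∑ x, p x * Real.log (p x / r x) : ℝ) : EReal) else ⊤

/-- `D(p‖M) = inf_{r ∈ M} D(p‖r)`. -/
def divergenceFrom (p : X → ℝ) (M : Set (X → ℝ)) : EReal :=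
  ⨅ r ∈ M, klDivergence p r

/-- `D_M`, the largest value of `D(p‖M)` over all probability distributions `p` on `X`. -/
def maxDivergence (M : Set (X → ℝ)) : EReal :=
  ⨆ p ∈ stdSimplex ℝ X, divergenceFrom p M

end Divergence

/-! ### Deep belief networks -/

variable {n : ℕ}

/-- The joint states of one layer, whose units `i : Fin n` have state spaces of cardinality
`q i`. -/
abbrev State (q : Fin n → ℕ) : Type := ∀ i, Fin (q i)

/-- The parameters that join two consecutive layers: an interaction table for each pair of a unit
`i` of the lower layer and a unit `j` of the upper layer, and a bias for each unit of the lower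
layer. For binary units the tables give the same conditional distributions, and the same joint
distributions of a restricted Boltzmann machine, as scalar weights and scalar biases do. -/
structure LayerParams (q : Fin n → ℕ) where
  weight : ∀ i j : Fin n, Fin (q i) → Fin (q j) → ℝ
  bias : ∀ i : Fin n, Fin (q i) → ℝ

variable {q : Fin n → ℕ}

/-- The input to state `a` of the lower unit `i`, given the state `z` of the upper layer. -/
def LayerParams.input (θ : LayerParams q) (z : State q) (i : Fin n) (a : Fin (q i)) : ℝ :=
  θ.bias i a + ∑ j, θ.weight i j a (z j)

/-- The directed interaction: the conditional probability of the state `x` of the lower layer given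
the state `z` of the upper layer. The lower units are independent given `z`. -/
def LayerParams.conditional (θ : LayerParams q) (x z : State q) : ℝ :=
  ∏ i, Real.exp (θ.input z i (x i)) / ∑ a, Real.exp (θ.input z i a)

/-- The Boltzmann weight of a pair (lower state, upper state) in the restricted Boltzmann machine
with interactions and lower biases `θ` and upper biases `c`. -/
def rbmWeight (θ : LayerParams q) (c : ∀ j : Fin n, Fin (q j) → ℝ) (x z : State q) : ℝ :=
  Real.exp (∑ i, θ.bias i (x i) + ∑ j, c j (z j) + ∑ i, ∑ j, θ.weight i j (x i) (z j))

/-- The joint distribution of the two layers of the restricted Boltzmann machine. -/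
def rbmJoint (θ : LayerParams q) (c : ∀ j : Fin n, Fin (q j) → ℝ) (x z : State q) : ℝ :=
  rbmWeight θ c x z / ∑ x', ∑ z', rbmWeight θ c x' z'

/-- The parameters of a deep belief network with `T + 2` layers: `T` directed pairs of consecutive
layers below one undirected pair (the restricted Boltzmann machine on the deepest two layers). -/
structure DBNParams (q : Fin n → ℕ) (T : ℕ) where
  directed : Fin T → LayerParams q
  top : LayerParams q
  topBias : ∀ j : Fin n, Fin (q j) → ℝ

/-- The joint distribution of the layers `h 0, …, h (T + 1)`, where `h 0` is the visible layer. -/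
def DBNParams.joint {T : ℕ} (θ : DBNParams q T) (h : Fin (T + 2) → State q) : ℝ :=
  (∏ l : Fin T, (θ.directed l).conditional (h l.castSucc.castSucc) (h l.succ.castSucc)) *
    rbmJoint θ.top θ.topBias (h (Fin.last T).castSucc) (h (Fin.last (T + 1)))

/-- The distribution of the visible layer: sum the joint distribution over the hidden layers. -/
def DBNParams.visible {T : ℕ} (θ : DBNParams q T) (x : State q) : ℝ :=
  ∑ g : Fin (T + 1) → State q, θ.joint (Fin.cons x g : Fin (T + 2) → State q)

/-- The model `DBN`: all visible distributions of the deep belief networks with `L ≥ 2` layers,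
each of which consists of units with state spaces of cardinalities `q i`, `i : Fin n`. -/
def dbnModel (q : Fin n → ℕ) (L : ℕ) : Set (State q → ℝ) :=
  {p | ∃ T : ℕ, L = T + 2 ∧ ∃ θ : DBNParams q T, p = θ.visible}

end DeepBelief

end

/-! Call the joint states of the units beyond `m + 1` blocks; by hypothesis there are at most `m` of
them. Number the blocks by distinct residues modulo `m`, and in phase `t` let block `b` use the
sharing unit obtained by shifting its residue by `t`. In each phase different blocks then use
different units, so one directed layer can redistribute mass in all blocks at once. Over `m` phases
each block uses every one of the first `m` units once.

The undirected pair can start from any positive choice of masses for pairs (block, state of the free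
unit `m + 1`). Inside a block, the units of the first `S` phases sit at a default state and those of
later phases are uniform (`stage_zero_mem_closure`). In phase `r` every block splits its mass over
the states of its next unit. The conditional law may depend on the states of the `r` units already
used, and one layer treats one joint state of them (`exists_share_kernel`, `stage_insert`). So phase
`r` takes at most `q₁ ^ r` layers, and `S` phases take the geometric sum in the hypothesis.

Hence the closure of the model contains every positive distribution that depends only on the block,
the free unit and the units of the first `S` phases (`mem_closure_dbnModel`). Averaging a
distribution over the classes of states agreeing there costs at most the logarithm of the largest
class size (`maxDivergence_le_log_of_setoid`). A class leaves `m - S` of the first `m` units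
undetermined, and by monotonicity of `q` its size is at most the product of the `m - S` largest
cardinalities.

Deterministic copying and exact zeros occur only as limits of parameters, so the constructions take
place in closures. Positivity of the model makes this harmless for the divergence. -/

noncomputable section

namespace DeepBelief

open Filter Topology Function

variable {n : ℕ} {q : Fin n → ℕ}

/-! ### Composition of layers -/

/-- Add a directed layer below a deep belief network. -/
def DBNParams.addLayer {T : ℕ} (θ : DBNParams q T) (κ : LayerParams q) : DBNParams q (T + 1) where
  directed := Fin.cons κ θ.directed
  top := θ.top
  topBias := θ.topBias

theorem DBNParams.visible_addLayer {T : ℕ} (θ : DBNParams q T) (κ : LayerParams q) (x : State q) :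
    (θ.addLayer κ).visible x = ∑ z, κ.conditional x z * θ.visible z := by
  unfold DBNParams.visible
  rw [← (Fin.consEquiv (fun _ : Fin (T + 2) => State q)).sum_comp, Fintype.sum_prod_type]
  refine Finset.sum_congr rfl fun z _ => ?_
  rw [Finset.mul_sum]
  refine Finset.sum_congr rfl fun g _ => ?_
  unfold DBNParams.joint
  rw [Fin.prod_univ_succ]
  simp only [DBNParams.addLayer, Fin.cons_zero, Fin.cons_succ]
  rw [mul_assoc]
  rfl

theorem DBNParams.eq_addLayer {T : ℕ} (θ : DBNParams q (T + 1)) :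
    θ = (DBNParams.mk (fun l => θ.directed l.succ) θ.top θ.topBias).addLayer (θ.directed 0) := by
  cases θ with
  | mk d t b =>
    simp only [DBNParams.addLayer, DBNParams.mk.injEq, and_self, and_true]
    exact (Fin.cons_self_tail d).symm

theorem LayerParams.sum_conditional (κ : LayerParams q) (z : State q) :
    ∑ x, κ.conditional x z = 1 := by
  unfold LayerParams.conditional
  rw [← Fintype.piFinset_univ, ← Finset.prod_univ_sum (fun _ => Finset.univ)
    (fun i a => Real.exp (κ.input z i a) / ∑ a, Real.exp (κ.input z i a))]
  refine Finset.prod_eq_one fun i _ => ?_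
  rw [← Finset.sum_div]
  refine div_self (ne_of_gt (Finset.sum_pos (fun a _ => Real.exp_pos _) ⟨z i, Finset.mem_univ _⟩))

theorem LayerParams.conditional_pos (κ : LayerParams q) (x z : State q) :
    0 < κ.conditional x z :=
  Finset.prod_pos fun i _ => div_pos (Real.exp_pos _)
    (Finset.sum_pos (fun _ _ => Real.exp_pos _) ⟨z i, Finset.mem_univ _⟩)

theorem DBNParams.visible_zero (θ : DBNParams q 0) (x : State q) :
    θ.visible x = ∑ z, rbmJoint θ.top θ.topBias x z := by
  unfold DBNParams.visible
  rw [← (Equiv.funUnique (Fin 1) (State q)).symm.sum_comp]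
  refine Finset.sum_congr rfl fun z _ => ?_
  unfold DBNParams.joint
  simp only [Finset.univ_eq_empty, Finset.prod_empty, one_mul]
  rfl

theorem rbmWeight_pos (θ : LayerParams q) (c : ∀ j : Fin n, Fin (q j) → ℝ) (x z : State q) :
    0 < rbmWeight θ c x z := Real.exp_pos _

theorem DBNParams.visible_pos {T : ℕ} (θ : DBNParams q T) (x : State q) : 0 < θ.visible x := by
  induction T generalizing x with
  | zero =>
    rw [DBNParams.visible_zero]
    refine Finset.sum_pos (fun z _ => div_pos (rbmWeight_pos _ _ _ _) ?_) ⟨x, Finset.mem_univ _⟩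
    exact Finset.sum_pos (fun z _ => Finset.sum_pos (fun _ _ => rbmWeight_pos _ _ _ _)
      ⟨x, Finset.mem_univ _⟩) ⟨x, Finset.mem_univ _⟩
  | succ T ih =>
    rw [θ.eq_addLayer, DBNParams.visible_addLayer]
    exact Finset.sum_pos (fun z _ => mul_pos (LayerParams.conditional_pos _ _ _) (ih _ _))
      ⟨x, Finset.mem_univ _⟩

theorem DBNParams.sum_visible [Nonempty (State q)] {T : ℕ} (θ : DBNParams q T) :
    ∑ x, θ.visible x = 1 := by
  induction T with
  | zero =>
    simp only [DBNParams.visible_zero, rbmJoint, ← Finset.sum_div]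
    refine div_self (ne_of_gt ?_)
    exact Finset.sum_pos (fun z _ => Finset.sum_pos (fun _ _ => rbmWeight_pos _ _ _ _)
      Finset.univ_nonempty) Finset.univ_nonempty
  | succ T ih =>
    rw [θ.eq_addLayer]
    simp only [DBNParams.visible_addLayer]
    rw [Finset.sum_comm]
    simp only [← Finset.sum_mul, LayerParams.sum_conditional, one_mul, ih]

theorem sum_eq_one_of_mem_closure [Nonempty (State q)] {L : ℕ} {p : State q → ℝ}
    (hp : p ∈ closure (dbnModel q L)) : ∑ x, p x = 1 := by
  have hc : IsClosed {p : State q → ℝ | ∑ x, p x = 1} :=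
    isClosed_eq (by fun_prop) continuous_const
  refine closure_minimal ?_ hc hp
  rintro _ ⟨T, -, θ, rfl⟩
  exact θ.sum_visible

/-- Applying a kernel to a distribution is jointly continuous, so limit kernels may be stacked on
limit distributions, one layer each. -/
theorem apply_mem_closure {T : ℕ} {p : State q → ℝ} {K : State q → State q → ℝ}
    (hp : p ∈ closure (dbnModel q (T + 2)))
    (hK : K ∈ closure (Set.range (LayerParams.conditional (q := q)))) :
    (fun x => ∑ z, K x z * p z) ∈ closure (dbnModel q (T + 1 + 2)) := by
  refine map_mem_closure₂ (f := fun (K : State q → State q → ℝ) (p : State q → ℝ) x =>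
    ∑ z, K x z * p z) (by fun_prop) hK hp ?_
  rintro _ ⟨κ, rfl⟩ _ ⟨T', hT, θ, rfl⟩
  obtain rfl : T = T' := by omega
  exact ⟨T + 1, rfl, θ.addLayer κ, funext fun x => (θ.visible_addLayer κ x).symm⟩

/-! ### Limits of the conditional distributions of a layer -/

theorem tendsto_exp_add_mul (α g G : ℝ) (hg : g ≤ G) :
    Tendsto (fun N : ℕ => Real.exp (α + N * g - N * G)) atTop
      (𝓝 (if g = G then Real.exp α else 0)) := by
  split_ifs with h
  · subst h
    simp
  · have hlt : g - G < 0 := by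
      rcases hg.lt_or_eq with h' | h'
      · linarith
      · exact absurd h' h
    have h1 : Tendsto (fun N : ℕ => α + (N : ℝ) * (g - G)) atTop atBot :=
      tendsto_atBot_add_const_left _ _
        ((tendsto_natCast_atTop_atTop (R := ℝ)).atTop_mul_const_of_neg hlt)
    refine (Real.tendsto_exp_atBot.comp h1).congr fun N => ?_
    simp only [Function.comp]
    ring_nf

/-- Dividing numerator and denominator by `exp (N * G)` kills every state where `g` is not maximal;
on the maximizers the softmax of `α` survives. -/
theorem tendsto_softmax {A : Type*} [Fintype A] (α g : A → ℝ) (G : ℝ) (hg : ∀ a, g a ≤ G)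
    (hG : ∃ a, g a = G) (a : A) :
    Tendsto (fun N : ℕ => Real.exp (α a + N * g a) / ∑ a', Real.exp (α a' + N * g a')) atTop
      (𝓝 ((if g a = G then Real.exp (α a) else 0) /
        ∑ a', if g a' = G then Real.exp (α a') else 0)) := by
  have hpos : (∑ a', if g a' = G then Real.exp (α a') else 0) ≠ 0 := by
    refine ne_of_gt (Finset.sum_pos' (fun a' _ => ?_) ?_)
    · split_ifs
      exacts [(Real.exp_pos _).le, le_rfl]
    · obtain ⟨a', ha'⟩ := hG
      exact ⟨a', Finset.mem_univ _, by simp [ha', Real.exp_pos]⟩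
  refine ((tendsto_exp_add_mul (α a) (g a) G (hg a)).div
    (tendsto_finsetSum _ fun a' _ => tendsto_exp_add_mul (α a') (g a') G (hg a')) hpos).congr
    fun N => ?_
  simp only [Pi.div_apply, Real.exp_sub, ← Finset.sum_div]
  rw [div_div_div_cancel_right₀ (Real.exp_ne_zero _)]

open Classical in
/-- The limit kernel of a layer in which each active unit `i` draws its state from the distribution
given by `θ` if the upper layer agrees with `v i` on `J i` and at `i`; in all other cases the units
copy their states from the upper layer. -/
def resampleKernel (θ : LayerParams q) (act : Set (Fin n)) (J : Fin n → Finset (Fin n))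
    (v : Fin n → State q) (x z : State q) : ℝ :=
  ∏ i, if i ∈ act ∧ z i = v i i ∧ ∀ j ∈ J i, z j = v i j then
    Real.exp (θ.input z i (x i)) / ∑ a, Real.exp (θ.input z i a)
  else if x i = z i then 1 else 0

open Classical in
/-- The direction in parameter space along which the conditional distributions converge to a
`resampleKernel`. -/
def resampleDirection (act : Set (Fin n)) (J : Fin n → Finset (Fin n))
    (v : Fin n → State q) : LayerParams q where
  bias _ _ := 0
  weight i j a c :=
    if i ∈ act then
      (if h : j = i then (if a = h ▸ c ∧ a ≠ v i i then (n + 1 : ℝ) else 0) else 0) +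
        if a = v i i ∧ j ∈ J i ∧ c ≠ v i j then 1 else 0
    else if h : j = i then (if a = h ▸ c then 1 else 0) else 0

open Classical in
theorem resampleDirection_input_of_mem {act : Set (Fin n)} (J : Fin n → Finset (Fin n))
    (v : Fin n → State q) {i : Fin n} (hi : i ∈ act) (z : State q) (a : Fin (q i)) :
    (resampleDirection act J v).input z i a =
      (if a = z i ∧ a ≠ v i i then (n + 1 : ℝ) else 0) +
        if a = v i i then (((J i).filter fun j => z j ≠ v i j).card : ℝ) else 0 := by
  simp only [LayerParams.input, resampleDirection, if_pos hi, zero_add, Finset.sum_add_distrib]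
  congr 1
  · rw [Finset.sum_eq_single i]
    · simp
    · intro j _ hj
      simp [hj]
    · simp
  · split_ifs with h
    · simp [h, Finset.sum_boole, Finset.filter_and]
      congr 1
      ext j
      simp
    · simp [h]

open Classical in
theorem resampleDirection_input_of_notMem {act : Set (Fin n)} (J : Fin n → Finset (Fin n))
    (v : Fin n → State q) {i : Fin n} (hi : i ∉ act) (z : State q) (a : Fin (q i)) :
    (resampleDirection act J v).input z i a = if a = z i then 1 else 0 := by
  simp only [LayerParams.input, resampleDirection, if_neg hi, zero_add]
  rw [Finset.sum_eq_single i]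
  · simp
  · intro j _ hj
    simp [hj]
  · simp

/-- Along `resampleDirection`, copying a state other than `v i i` scores `n + 1`, while `v i i`
scores the number of mismatches on `J i`, which is at most `n`. So the copied state wins strictly,
except at `z i = v i i` without mismatch: there all scores are zero and `θ` alone decides. -/
theorem resampleKernel_mem_closure (θ : LayerParams q) (act : Set (Fin n))
    (J : Fin n → Finset (Fin n)) (v : Fin n → State q) :
    resampleKernel θ act J v ∈ closure (Set.range (LayerParams.conditional (q := q))) := by
  classical
  set γ := resampleDirection act J v with hγ
  let Θ : ℕ → LayerParams q := fun N =>
    { bias := fun i a => θ.bias i a + N * γ.bias i a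
      weight := fun i j a c => θ.weight i j a c + N * γ.weight i j a c }
  have hΘ : ∀ N z i a, (Θ N).input z i a = θ.input z i a + N * γ.input z i a := by
    intro N z i a
    simp only [Θ, LayerParams.input, Finset.sum_add_distrib, mul_add, Finset.mul_sum]
    ring
  refine mem_closure_of_tendsto (f := fun N => (Θ N).conditional) (b := atTop) ?_
    (Eventually.of_forall fun N => ⟨Θ N, rfl⟩)
  rw [tendsto_pi_nhds]
  intro x
  rw [tendsto_pi_nhds]
  intro z
  unfold LayerParams.conditional resampleKernel
  refine tendsto_finsetProd _ fun i _ => ?_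
  simp only [hΘ]
  have key : ∀ (G : ℝ) (b : Fin (q i)), γ.input z i b = G → (∀ a, a ≠ b → γ.input z i a < G) →
      Tendsto (fun N : ℕ => Real.exp (θ.input z i (x i) + N * γ.input z i (x i)) /
        ∑ a, Real.exp (θ.input z i a + N * γ.input z i a)) atTop
        (𝓝 (if x i = b then 1 else 0)) := by
    intro G b hb hlt
    have hiff : ∀ a, γ.input z i a = G ↔ a = b := fun a =>
      ⟨fun h => by_contra fun hne => (hlt a hne).ne h, fun h => h ▸ hb⟩
    have := tendsto_softmax (θ.input z i) (γ.input z i) G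
      (fun a => by by_cases h : a = b
                   · exact (h ▸ hb).le
                   · exact (hlt a h).le) ⟨b, hb⟩ (x i)
    simp only [hiff, Finset.sum_ite_eq', Finset.mem_univ, if_true] at this
    convert this using 2
    split_ifs with h
    · rw [h, div_self (Real.exp_ne_zero _)]
    · simp
  by_cases hi : i ∈ act
  · have hin := fun a => resampleDirection_input_of_mem J v hi z a
    rw [← hγ] at hin
    by_cases hz : z i = v i i
    · by_cases hJ : ∀ j ∈ J i, z j = v i j
      · rw [if_pos ⟨hi, hz, hJ⟩]
        have h0 : ∀ a, γ.input z i a = 0 := by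
          intro a
          have hf : (J i).filter (fun j => z j ≠ v i j) = ∅ := by
            simpa [Finset.filter_eq_empty_iff] using hJ
          rw [hin, hf]
          simp [hz]
        simp only [h0, mul_zero, add_zero]
        exact tendsto_const_nhds
      · rw [if_neg (by tauto), hz]
        have hpos : 0 < (((J i).filter fun j => z j ≠ v i j).card : ℝ) := by
          push Not at hJ
          obtain ⟨j, hj, hne⟩ := hJ
          exact_mod_cast Finset.card_pos.2 ⟨j, Finset.mem_filter.2 ⟨hj, hne⟩⟩
        refine key _ (v i i) rfl fun a ha => ?_
        rw [hin, hin]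
        simpa [ha, hz] using hpos
    · rw [if_neg (by tauto)]
      refine key _ (z i) rfl fun a ha => ?_
      have hle : (((J i).filter fun j => z j ≠ v i j).card : ℝ) < n + 1 := by
        have := Finset.card_le_univ ((J i).filter fun j => z j ≠ v i j)
        rw [Fintype.card_fin] at this
        exact_mod_cast Nat.lt_succ_of_le this
      rw [hin, hin]
      simp only [ha, false_and, if_false, zero_add, hz, ne_eq, not_false_eq_true, and_self, if_true,
        add_zero]
      split_ifs
      · exact hle
      · positivity
  · rw [if_neg (by tauto)]
    have hin := fun a => resampleDirection_input_of_notMem J v hi z a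
    rw [← hγ] at hin
    refine key 1 (z i) (by simp [hin]) fun a ha => ?_
    simp [hin, ha]

theorem resampleKernel_empty (θ : LayerParams q) (J : Fin n → Finset (Fin n))
    (v : Fin n → State q) (x z : State q) :
    resampleKernel θ ∅ J v x z = if z = x then 1 else 0 := by
  classical
  unfold resampleKernel
  simp only [Set.mem_empty_iff_false, false_and, if_false]
  rw [Fintype.prod_ite_zero]
  simp only [Finset.prod_const_one]
  exact if_congr ⟨fun h => funext fun i => (h i).symm, fun h i => by rw [h]⟩ rfl rfl

/-- With no active unit the limit kernel is the identity, so surplus layers can copy. -/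
theorem closure_dbnModel_mono (o : State q) {T T' : ℕ} (h : T ≤ T') :
    closure (dbnModel q (T + 2)) ⊆ closure (dbnModel q (T' + 2)) := by
  induction T', h using Nat.le_induction with
  | base => exact subset_rfl
  | succ T' _ ih =>
    intro p hp
    have := apply_mem_closure (ih hp) (resampleKernel_mem_closure ⟨fun _ _ _ _ => 0, fun _ _ => 0⟩ ∅
      (fun _ => ∅) (fun _ => o))
    simpa [resampleKernel_empty] using this

/-! ### Limits of restricted Boltzmann machines -/

theorem sum_rbmWeight (θ : LayerParams q) (c : ∀ j : Fin n, Fin (q j) → ℝ) (x : State q) :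
    ∑ z, rbmWeight θ c x z =
      Real.exp (∑ i, θ.bias i (x i)) *
        ∏ j, ∑ a, Real.exp (c j a + ∑ i, θ.weight i j (x i) a) := by
  have h : ∀ z, rbmWeight θ c x z = Real.exp (∑ i, θ.bias i (x i)) *
      ∏ j, Real.exp (c j (z j) + ∑ i, θ.weight i j (x i) (z j)) := by
    intro z
    rw [rbmWeight, ← Real.exp_sum, ← Real.exp_add, Finset.sum_add_distrib, Finset.sum_comm,
      add_assoc]
  simp only [h, ← Finset.mul_sum]
  congr 1
  rw [Finset.prod_univ_sum, Fintype.piFinset_univ]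

theorem tendsto_exp_neg_mul_one_add (k : ℕ) (t : ℝ) :
    Tendsto (fun N : ℕ => Real.exp (-N) * (1 + Real.exp (N - 2 * N * k + t))) atTop
      (𝓝 (if k = 0 then Real.exp t else 0)) := by
  have h0 : Tendsto (fun N : ℕ => Real.exp (-(N : ℝ))) atTop (𝓝 0) :=
    Real.tendsto_exp_neg_atTop_nhds_zero.comp tendsto_natCast_atTop_atTop
  have h := h0.add (tendsto_exp_add_mul t (-2 * k) 0 (by linarith [(Nat.cast_nonneg k : (0:ℝ) ≤ k)]))
  rw [zero_add] at h
  have hk : (-2 * (k : ℝ) = 0) ↔ k = 0 := by simp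
  simp only [hk] at h
  refine h.congr fun N => ?_
  rw [mul_add, mul_one, ← Real.exp_add]
  congr 2
  ring

theorem tendsto_one_add_exp (k : ℕ) (hk : k ≠ 0) (t : ℝ) :
    Tendsto (fun N : ℕ => 1 + Real.exp (N - 2 * N * k + t)) atTop (𝓝 1) := by
  have hk1 : (1 : ℝ) ≤ k := by exact_mod_cast Nat.one_le_iff_ne_zero.2 hk
  have h := (tendsto_exp_add_mul t (1 - 2 * k) 0 (by linarith)).const_add 1
  rw [if_neg (by linarith), add_zero] at h
  refine h.congr fun N => ?_
  congr 2
  ring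

open Classical in
/-- A restricted Boltzmann machine approximates each distribution that is proportional to a mixture
of product distributions with supports in disjoint cylinder sets, if each component has a hidden
unit of its own. -/
theorem mem_closure_dbnModel_two (o : State q) (P : State q → ℝ) (act : Set (Fin n))
    (hq : ∀ j ∈ act, 2 ≤ q j) (J : Fin n → Finset (Fin n)) (v : Fin n → State q)
    (κ : LayerParams q) (hP : 0 < ∑ x, P x)
    (h : ∀ x, ∃ j ∈ act, (∀ j' ∈ act, j' ≠ j → ∃ i ∈ J j', x i ≠ v j' i) ∧
      P x = if ∀ i ∈ J j, x i = v j i then Real.exp (κ.bias j (o j) + ∑ i, κ.weight i j (x i) (o j))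
        else 0) :
    (fun x => (∑ y, P y)⁻¹ * P x) ∈ closure (dbnModel q 2) := by
  let count : Fin n → State q → ℕ := fun j x => ((J j).filter fun i => x i ≠ v j i).card
  have hcount : ∀ j x, count j x = 0 ↔ ∀ i ∈ J j, x i = v j i := by
    intro j x
    simp [count, Finset.filter_eq_empty_iff]
  -- After summing out hidden unit `j`, its factor is `1 + exp (N - 2 * N * count + t)`. The
  -- subtracted `log (q j - 1)` merges the `q j - 1` non-default states into one exponential. Scaled
  -- by `exp (-N)`, the factor tends to `exp t` on its cylinder and to zero off it; unscaled, it
  -- tends to `1` off it.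
  let Θ : ℕ → LayerParams q := fun N =>
    { bias := fun _ _ => 0
      weight := fun i j a c => if j ∈ act ∧ c ≠ o j then
        κ.weight i j a (o j) - 2 * N * (if i ∈ J j ∧ a ≠ v j i then 1 else 0) else 0 }
  let C : ℕ → ∀ j : Fin n, Fin (q j) → ℝ := fun N j c => if j ∈ act ∧ c ≠ o j then
    N + κ.bias j (o j) - Real.log (q j - 1) else 0
  let Z : ℕ → State q → ℝ := fun N x => Real.exp (-N) * ∑ z, rbmWeight (Θ N) (C N) x z
  let D : ℝ := ∏ j, if j ∈ act then 1 else (q j : ℝ)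
  let t : Fin n → State q → ℝ := fun j x => κ.bias j (o j) + ∑ i, κ.weight i j (x i) (o j)
  have hD : 0 < D := by
    refine Finset.prod_pos fun j _ => ?_
    split_ifs
    · exact one_pos
    · exact_mod_cast (o j).pos
  have hZ : ∀ N x, Z N x = Real.exp (-N) * ∏ j, (if j ∈ act then 1 else (q j : ℝ)) *
      if j ∈ act then 1 + Real.exp (N - 2 * N * count j x + t j x) else 1 := by
    intro N x
    simp only [Z]
    rw [sum_rbmWeight]
    have : Real.exp (∑ i, (Θ N).bias i (x i)) = 1 := by simp [Θ]
    rw [this, one_mul]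
    congr 1
    refine Finset.prod_congr rfl fun j _ => ?_
    by_cases hj : j ∈ act
    · simp only [hj, if_true, one_mul]
      rw [← Finset.add_sum_erase _ _ (Finset.mem_univ (o j))]
      congr 1
      · simp [C, Θ]
      · have hc : ∀ c ∈ Finset.univ.erase (o j),
            Real.exp (C N j c + ∑ i, (Θ N).weight i j (x i) c) =
            Real.exp (N - 2 * N * count j x + t j x) / (q j - 1) := by
          intro c hc
          have hc' : c ≠ o j := Finset.ne_of_mem_erase hc
          have h1 : (0 : ℝ) < q j - 1 := by
            have : (2 : ℝ) ≤ q j := by exact_mod_cast hq j hj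
            linarith
          rw [← Real.exp_log h1, ← Real.exp_sub]
          congr 1
          simp only [C, Θ, hj, hc', true_and, ne_eq, not_false_eq_true, if_true,
            Finset.sum_sub_distrib, ← Finset.mul_sum, t, count]
          rw [Finset.sum_boole]
          have : (Finset.univ.filter fun i => i ∈ J j ∧ ¬ x i = v j i) =
              (J j).filter fun i => ¬ x i = v j i := by
            ext i
            simp
          rw [this]
          ring
        rw [Finset.sum_congr rfl hc, Finset.sum_const, Finset.card_erase_of_mem (Finset.mem_univ _),
          Finset.card_univ, Fintype.card_fin, nsmul_eq_mul, Nat.cast_sub (by linarith [hq j hj])]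
        have h1 : (q j : ℝ) - 1 ≠ 0 := by
          have : (2 : ℝ) ≤ q j := by exact_mod_cast hq j hj
          linarith
        push_cast
        field_simp
    · simp [hj, C, Θ]
  have hlim : ∀ x, Tendsto (fun N => Z N x) atTop (𝓝 (D * P x)) := by
    intro x
    obtain ⟨j, hj, hother, hPx⟩ := h x
    simp only [hZ, Finset.prod_mul_distrib]
    have h1 : ∀ N : ℕ, Real.exp (-N) * (D * ∏ j,
        if j ∈ act then 1 + Real.exp (N - 2 * N * count j x + t j x) else 1) =
        D * ((Real.exp (-N) * (1 + Real.exp (N - 2 * N * count j x + t j x))) *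
        ∏ j' ∈ Finset.univ.erase j,
          if j' ∈ act then 1 + Real.exp (N - 2 * N * count j' x + t j' x) else 1) := by
      intro N
      rw [← Finset.mul_prod_erase _ _ (Finset.mem_univ j), if_pos hj]
      ring
    refine Tendsto.congr (fun N => (h1 N).symm) ?_
    refine Tendsto.const_mul D ?_
    rw [hPx, ← mul_one (ite _ _ _)]
    refine Tendsto.mul ?_ ?_
    · simpa only [hcount] using tendsto_exp_neg_mul_one_add (count j x) (t j x)
    · suffices hone : Tendsto (fun N : ℕ => ∏ j' ∈ Finset.univ.erase j,
          if j' ∈ act then 1 + Real.exp (N - 2 * N * count j' x + t j' x) else 1) atTop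
          (𝓝 (∏ j' ∈ Finset.univ.erase j, 1)) by rwa [Finset.prod_const_one] at hone
      refine tendsto_finsetProd _ fun j' hj' => ?_
      split_ifs with hact
      · refine tendsto_one_add_exp _ ?_ _
        rw [Ne, hcount]
        obtain ⟨i, hi, hne⟩ := hother j' hact (Finset.ne_of_mem_erase hj')
        exact fun hall => hne (hall i hi)
      · exact tendsto_const_nhds
  refine mem_closure_of_tendsto (b := atTop)
    (f := fun N => DBNParams.visible (T := 0) ⟨Fin.elim0, Θ N, C N⟩) ?_
    (Eventually.of_forall fun N => ⟨0, rfl, _, rfl⟩)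
  rw [tendsto_pi_nhds]
  intro x
  have h2 := (hlim x).div (tendsto_finsetSum Finset.univ fun y _ => hlim y)
    (by rw [← Finset.mul_sum]; positivity)
  have h3 : (∑ y, P y)⁻¹ * P x = D * P x / ∑ y, D * P y := by
    rw [← Finset.mul_sum, mul_div_mul_left _ _ hD.ne', div_eq_inv_mul]
  rw [h3]
  refine h2.congr fun N => ?_
  simp only [Pi.div_apply]
  rw [DBNParams.visible_zero]
  simp only [rbmJoint, Z, ← Finset.mul_sum, ← Finset.sum_div]
  rw [mul_div_mul_left _ _ (Real.exp_ne_zero _)]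

/-! ### Sharing schemes -/

/-- A scheme for simultaneous probability sharing. The states of the units in `fixed` determine the
block of a state of the layer. In the phase `t`, the unit `unit b t` shares the mass of block `b`.
At most one unit, the member of `free`, has no role. -/
structure Scheme (q : Fin n → ℕ) (β : Type) where
  block : State q → β
  fixed : Finset (Fin n)
  free : Finset (Fin n)
  unit : β → ℕ → Fin n
  length : ℕ
  block_eq_iff : ∀ {x y}, block x = block y ↔ ∀ i ∈ fixed, x i = y i
  block_surjective : Surjective block
  unit_notMem : ∀ b t, unit b t ∉ fixed
  unit_injective_block : ∀ t, Injective fun b => unit b t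
  unit_injOn : ∀ b, Set.InjOn (unit b) (Set.Iio length)
  cover : ∀ b i, i ∈ fixed ∨ i ∈ free ∨ ∃ t < length, i = unit b t
  card_free : free.card ≤ 1
  two_le : ∀ b t, 2 ≤ q (unit b t)

namespace Scheme

variable {β : Type} (A : Scheme q β)

theorem block_update (x : State q) (b : β) (t : ℕ) (a) :
    A.block (update x (A.unit b t) a) = A.block x :=
  A.block_eq_iff.2 fun i hi => update_of_ne (fun h => A.unit_notMem b t (by rwa [← h])) _ _

/-- Two states agree in their block, in the free unit and in the sharing units of the first `d`
phases. -/
def AgreeUpTo (d : ℕ) (x y : State q) : Prop :=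
  ∀ i, (i ∈ A.fixed ∨ i ∈ A.free ∨ ∃ t < d, i = A.unit (A.block x) t) → x i = y i

variable {A}

theorem AgreeUpTo.block_eq {d : ℕ} {x y : State q} (h : A.AgreeUpTo d x y) :
    A.block x = A.block y :=
  A.block_eq_iff.2 fun i hi => h i (Or.inl hi)

theorem AgreeUpTo.refl (d : ℕ) (x : State q) : A.AgreeUpTo d x x := fun _ _ => rfl

theorem AgreeUpTo.symm {d : ℕ} {x y : State q} (h : A.AgreeUpTo d x y) : A.AgreeUpTo d y x :=
  fun i hi => (h i (by rwa [h.block_eq])).symm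

theorem AgreeUpTo.trans {d : ℕ} {x y z : State q} (h : A.AgreeUpTo d x y)
    (h' : A.AgreeUpTo d y z) : A.AgreeUpTo d x z :=
  fun i hi => (h i hi).trans (h' i (by rwa [← h.block_eq]))

theorem AgreeUpTo.update_succ {d : ℕ} {x y : State q} (h : A.AgreeUpTo d x y)
    (a : Fin (q (A.unit (A.block x) d))) :
    A.AgreeUpTo (d + 1) (update x (A.unit (A.block x) d) a)
      (update y (A.unit (A.block x) d) a) := by
  intro i hi
  rw [A.block_update] at hi
  by_cases hid : i = A.unit (A.block x) d
  · subst hid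
    rw [update_self, update_self]
  · rw [update_of_ne hid, update_of_ne hid]
    refine h i (hi.imp_right (Or.imp_right ?_))
    rintro ⟨t, ht, rfl⟩
    refine ⟨t, lt_of_le_of_ne (Nat.lt_succ_iff.1 ht) ?_, rfl⟩
    rintro rfl
    exact hid rfl

/-! ### Marginals and the intermediate distributions of the phases -/

variable (A)

/-- Sum out the units that share in the last `k` of `S` phases. -/
def marginalAux (S : ℕ) (p : State q → ℝ) : ℕ → State q → ℝ
  | 0 => p
  | k + 1 => fun x => ∑ a, marginalAux S p k (update x (A.unit (A.block x) (S - 1 - k)) a)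

/-- Sum out the units that share in the phases `d, …, S - 1`. -/
def marginal (S : ℕ) (p : State q → ℝ) (d : ℕ) : State q → ℝ :=
  A.marginalAux S p (S - d)

theorem marginal_self (S : ℕ) (p : State q → ℝ) : A.marginal S p S = p := by
  simp [marginal, marginalAux]

theorem marginal_eq_sum {S d : ℕ} (p : State q → ℝ) (hd : d < S) (x : State q) :
    A.marginal S p d x = ∑ a, A.marginal S p (d + 1) (update x (A.unit (A.block x) d) a) := by
  have h1 : S - d = (S - (d + 1)) + 1 := by omega
  have h2 : S - 1 - (S - (d + 1)) = d := by omega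
  rw [marginal, h1, marginalAux, h2]
  rfl

theorem marginal_pos {S d : ℕ} {p : State q → ℝ} (hp : ∀ x, 0 < p x) (hd : d ≤ S) :
    ∀ x, 0 < A.marginal S p d x := by
  induction hd using Nat.decreasingInduction with
  | self => rwa [marginal_self]
  | of_succ d hd ih =>
    intro x
    rw [marginal_eq_sum _ _ hd]
    exact Finset.sum_pos (fun a _ => ih _) ⟨x _, Finset.mem_univ _⟩

theorem marginal_congr {S d : ℕ} {p : State q → ℝ} (hp : ∀ x y, A.AgreeUpTo S x y → p x = p y)
    (hd : d ≤ S) : ∀ x y, A.AgreeUpTo d x y → A.marginal S p d x = A.marginal S p d y := by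
  induction hd using Nat.decreasingInduction with
  | self => rwa [marginal_self]
  | of_succ d hd ih =>
    intro x y h
    rw [marginal_eq_sum _ _ hd, marginal_eq_sum _ _ hd, ← h.block_eq]
    exact Finset.sum_congr rfl fun a _ => ih _ _ (h.update_succ a)

/-- The states of the units that share in the first `r` phases. -/
def pre (r : ℕ) (x : State q) : Fin r → ℕ := fun t => (x (A.unit (A.block x) t)).val

open Classical in
/-- The number of finished phases at the state `x`, when in the phase `r` the sharing is done for
the states of the earlier units in `W`. -/
def depth (r : ℕ) (W : Finset (Fin r → ℕ)) (x : State q) : ℕ :=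
  if A.pre r x ∈ W then r + 1 else r

open Classical in
/-- The distribution in the phase `r`, when the sharing is done for the states of the earlier units
in `W`. -/
def stage (o : State q) (S : ℕ) (p : State q → ℝ) (r : ℕ) (W : Finset (Fin r → ℕ))
    (x : State q) : ℝ :=
  if ∀ t, A.depth r W x ≤ t → t < S → x (A.unit (A.block x) t) = o (A.unit (A.block x) t) then
    A.marginal S p (A.depth r W x) x else 0

/-- A function of the state of one unit is a bias plus a single interaction table. This is why at
most one unit may be free. -/
theorem eq_sum_of_card_le_one {U : Finset (Fin n)} (hU : U.card ≤ 1) (G : State q → ℝ)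
    (hG : ∀ x y : State q, (∀ i ∈ U, x i = y i) → G x = G y) (o z : State q) :
    G z = G o + ∑ i, if i ∈ U then G (update o i (z i)) - G o else 0 := by
  classical
  rcases Nat.le_one_iff_eq_zero_or_eq_one.1 hU with h | h
  · rw [Finset.card_eq_zero] at h
    subst h
    simpa using hG z o (by simp)
  · obtain ⟨u, rfl⟩ := Finset.card_eq_one.1 h
    simp only [Finset.mem_singleton, Finset.sum_ite_eq', Finset.mem_univ, if_true]
    rw [add_sub_cancel]
    exact hG _ _ (by simp)

/-- Replace the states of all units but the free one by those of `v`. -/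
def fill (v z : State q) : State q := fun i => if i ∈ A.free then z i else v i

-- Once the block and the earlier sharing units are prescribed, a marginal depends on the free unit
-- only, so it can be evaluated at `fill v z`.
variable {A} in
theorem agreeUpTo_fill {d : ℕ} {v z : State q} (hb : A.block z = A.block v)
    (hd : ∀ t < d, z (A.unit (A.block z) t) = v (A.unit (A.block z) t)) :
    A.AgreeUpTo d z (A.fill v z) := by
  intro i hi
  unfold fill
  split_ifs with h
  · rfl
  · rcases hi with hi | hi | ⟨t, ht, rfl⟩
    · exact A.block_eq_iff.1 hb i hi
    · exact absurd hi h
    · exact hd t ht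

theorem fill_congr (v : State q) {x y : State q} (h : ∀ i ∈ A.free, x i = y i) :
    A.fill v x = A.fill v y := by
  funext i
  unfold fill
  split_ifs with hi
  · exact h i hi
  · rfl

theorem exists_block_eq (o : State q) (b : β) :
    ∃ v, A.block v = b ∧ ∀ t, v (A.unit b t) = o (A.unit b t) := by
  classical
  obtain ⟨x, hx⟩ := A.block_surjective b
  refine ⟨fun i => if i ∈ A.fixed then x i else o i, ?_, fun t => if_neg (A.unit_notMem b t)⟩
  rw [← hx, A.block_eq_iff]
  exact fun i hi => if_pos hi

theorem depth_empty (r : ℕ) (x : State q) : A.depth r ∅ x = r := by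
  simp [depth]

theorem stage_nonneg (o : State q) {S r : ℕ} {p : State q → ℝ} (hp : ∀ x, 0 < p x) (hr : r ≤ S)
    (x : State q) : 0 ≤ A.stage o S p r ∅ x := by
  unfold stage
  split_ifs
  · rw [depth_empty]
    exact (A.marginal_pos hp hr x).le
  · exact le_rfl

theorem sum_stage_zero_pos (o : State q) {S : ℕ} {p : State q → ℝ} (hp : ∀ x, 0 < p x) :
    0 < ∑ x, A.stage o S p 0 ∅ x := by
  refine Finset.sum_pos' (fun x _ => A.stage_nonneg o hp (Nat.zero_le _) x) ⟨o, Finset.mem_univ _, ?_⟩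
  unfold stage
  rw [if_pos (fun _ _ _ => rfl), depth_empty]
  exact A.marginal_pos hp (Nat.zero_le _) o

/-- Each block is one mixture component, a product distribution on its own cylinder, with hidden
unit `unit b 0`. The log-marginal enters through the free unit; units of phases from `S` on get no
weights and stay uniform. -/
theorem stage_zero_mem_closure (o : State q) {S : ℕ} {p : State q → ℝ} (hp : ∀ x, 0 < p x)
    (hinv : ∀ x y, A.AgreeUpTo S x y → p x = p y) :
    (fun x => (∑ y, A.stage o S p 0 ∅ y)⁻¹ * A.stage o S p 0 ∅ x) ∈ closure (dbnModel q 2) := by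
  classical
  have : Nonempty β := ⟨A.block o⟩
  choose V hV hVo using A.exists_block_eq o
  let bl : Fin n → β := invFun fun b => A.unit b 0
  have hbl : ∀ b, bl (A.unit b 0) = b := leftInverse_invFun (A.unit_injective_block 0)
  let G : β → State q → ℝ := fun b z => Real.log (A.marginal S p 0 (A.fill (V b) z))
  have hG : ∀ b (x y : State q), (∀ i ∈ A.free, x i = y i) → G b x = G b y := by
    intro b x y h
    simp only [G, A.fill_congr (V b) h]
  refine mem_closure_dbnModel_two o _ (Set.range fun b => A.unit b 0) ?_
    (fun j => A.fixed ∪ (Finset.range S).image (A.unit (bl j))) (fun j => V (bl j))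
    ⟨fun i j a _ => if i ∈ A.free then G (bl j) (update o i a) - G (bl j) o else 0,
      fun j _ => G (bl j) o⟩ (A.sum_stage_zero_pos o hp) ?_
  · rintro _ ⟨b, rfl⟩
    exact A.two_le b 0
  · intro x
    refine ⟨A.unit (A.block x) 0, ⟨_, rfl⟩, ?_, ?_⟩
    · rintro _ ⟨b, rfl⟩ hne
      by_contra! hall
      simp only [hbl] at hall
      refine hne ?_
      have : A.block x = A.block (V b) :=
        A.block_eq_iff.2 fun i hi => hall i (Finset.mem_union_left _ hi)
      simp only [this, hV]
    · simp only [hbl]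
      rw [← eq_sum_of_card_le_one A.card_free (G (A.block x)) (hG _) o x]
      unfold stage
      simp only [depth_empty]
      refine if_congr ⟨fun h i hi => ?_, fun h t _ ht => ?_⟩ ?_ rfl
      · rcases Finset.mem_union.1 hi with hi | hi
        · exact A.block_eq_iff.1 (hV (A.block x)).symm i hi
        · obtain ⟨t, ht, rfl⟩ := Finset.mem_image.1 hi
          rw [hVo, h t (Nat.zero_le _) (Finset.mem_range.1 ht)]
      · rw [h _ (Finset.mem_union_right _ (Finset.mem_image_of_mem _ (Finset.mem_range.2 ht))), hVo]
      · rw [Real.exp_log (A.marginal_pos hp (Nat.zero_le _) _)]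
        exact A.marginal_congr hinv (Nat.zero_le _) _ _
          (agreeUpTo_fill (hV _).symm (by simp))

/-! ### One layer shares mass in all blocks -/

theorem pre_update {r : ℕ} (hr : r < A.length) (x : State q) (a) :
    A.pre r (update x (A.unit (A.block x) r) a) = A.pre r x := by
  funext t
  unfold pre
  rw [A.block_update, update_of_ne]
  intro h
  exact absurd (A.unit_injOn _ (t.2.trans hr) hr h) t.2.ne

variable {A} in
theorem eq_of_pre_eq {r : ℕ} {z v : State q} (hb : A.block z = A.block v)
    (h : A.pre r z = A.pre r v) {t : ℕ} (ht : t < r) :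
    z (A.unit (A.block z) t) = v (A.unit (A.block z) t) := by
  have := congrFun h ⟨t, ht⟩
  unfold pre at this
  rw [← hb] at this
  exact Fin.ext this

/-- The kernel that shares the mass of the states with `pre r z = w`. -/
theorem exists_share_kernel (o : State q) {S r : ℕ} (hr : r < S)
    {p : State q → ℝ} (hp : ∀ x, 0 < p x)
    (hinv : ∀ x y, A.AgreeUpTo S x y → p x = p y) (w : Fin r → ℕ) :
    ∃ K ∈ closure (Set.range (LayerParams.conditional (q := q))), ∀ x z,
      (¬ (A.pre r z = w ∧ z (A.unit (A.block z) r) = o (A.unit (A.block z) r)) →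
        K x z = if z = x then 1 else 0) ∧
      (A.pre r z = w ∧ z (A.unit (A.block z) r) = o (A.unit (A.block z) r) →
        K x z = if update x (A.unit (A.block z) r) (z (A.unit (A.block z) r)) = z then
          A.marginal S p (r + 1) x / A.marginal S p r z else 0) := by
  classical
  have : Nonempty β := ⟨A.block o⟩
  let Active : β → State q → Prop := fun b v =>
    A.block v = b ∧ A.pre r v = w ∧ v (A.unit b r) = o (A.unit b r)
  -- The prefix `w` may be impossible in some block. The default `o` is harmless there, since `act`
  -- excludes the unit of such a block.
  let V : β → State q := fun b => if h : ∃ v, Active b v then h.choose else o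
  have hV : ∀ b, (∃ v, Active b v) → Active b (V b) := by
    intro b h
    simp only [V, dif_pos h]
    exact h.choose_spec
  let bl : Fin n → β := invFun fun b => A.unit b r
  have hbl : ∀ b, bl (A.unit b r) = b := leftInverse_invFun (A.unit_injective_block r)
  -- The logits are logarithms of the next marginal, so the softmax normalizer is the current
  -- marginal.
  let G : ∀ i, Fin (q i) → State q → ℝ := fun i a z =>
    Real.log (A.marginal S p (r + 1) (update (A.fill (V (bl i)) z) i a))
  have hG : ∀ i a (x y : State q), (∀ j ∈ A.free, x j = y j) → G i a x = G i a y := by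
    intro i a x y h
    simp only [G, A.fill_congr _ h]
  let θ : LayerParams q :=
    ⟨fun i j a c => if j ∈ A.free then G i a (update o j c) - G i a o else 0, fun i a => G i a o⟩
  have hθ : ∀ z i a, θ.input z i a = G i a z := fun z i a =>
    (eq_sum_of_card_le_one A.card_free (G i a) (hG i a) o z).symm
  let act : Set (Fin n) := {i | ∃ b, i = A.unit b r ∧ ∃ v, Active b v}
  let J : Fin n → Finset (Fin n) := fun i => A.fixed ∪ (Finset.range r).image (A.unit (bl i))
  -- Units of other blocks see a mismatch in `fixed` and copy, so at each `z` at most the unit of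
  -- its own block resamples.
  have hmatch : ∀ (z : State q) i, (i ∈ act ∧ z i = V (bl i) i ∧ ∀ j ∈ J i, z j = V (bl i) j) ↔
      i = A.unit (A.block z) r ∧ A.pre r z = w ∧
        z (A.unit (A.block z) r) = o (A.unit (A.block z) r) := by
    intro z i
    constructor
    · rintro ⟨⟨b, rfl, hact⟩, hzi, hJ⟩
      simp only [J, hbl] at hzi hJ
      obtain ⟨h1, h2, h3⟩ := hV b hact
      have hbz : A.block z = b := by
        rw [← h1, A.block_eq_iff]
        exact fun j hj => hJ j (Finset.mem_union_left _ hj)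
      refine ⟨by rw [hbz], ?_, by rw [hbz, hzi, h3]⟩
      rw [← h2]
      funext t
      unfold pre
      rw [hbz, h1, hJ _ (Finset.mem_union_right _
        (Finset.mem_image_of_mem _ (Finset.mem_range.2 t.2)))]
    · rintro ⟨rfl, hpre, hzo⟩
      have hact : ∃ v, Active (A.block z) v := ⟨z, rfl, hpre, hzo⟩
      obtain ⟨h1, h2, h3⟩ := hV _ hact
      refine ⟨⟨_, rfl, hact⟩, ?_, ?_⟩
      · rw [hbl, h3, hzo]
      · simp only [J, hbl]
        intro j hj
        rcases Finset.mem_union.1 hj with hj | hj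
        · exact A.block_eq_iff.1 h1.symm j hj
        · obtain ⟨t, ht, rfl⟩ := Finset.mem_image.1 hj
          exact eq_of_pre_eq h1.symm (hpre.trans h2.symm) (Finset.mem_range.1 ht)
  refine ⟨_, resampleKernel_mem_closure θ act J (fun i => V (bl i)), fun x z => ⟨?_, ?_⟩⟩
  · intro hz
    unfold resampleKernel
    simp only [hmatch, hz, and_false, if_false]
    rw [Fintype.prod_ite_zero]
    simp only [Finset.prod_const_one]
    exact if_congr ⟨fun h => funext fun i => (h i).symm, fun h i => by rw [h]⟩ rfl rfl
  · intro hz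
    obtain ⟨h1, h2, h3⟩ := hV (A.block z) ⟨z, rfl, hz.1, hz.2⟩
    set i := A.unit (A.block z) r with hi
    have hmz := fun j => (hmatch z j).trans (and_iff_left hz)
    unfold resampleKernel
    simp only [hmz]
    rw [← Finset.mul_prod_erase _ _ (Finset.mem_univ i), if_pos hi]
    have hrest : (∏ j ∈ Finset.univ.erase i, if j = i then
        Real.exp (θ.input z j (x j)) / ∑ a, Real.exp (θ.input z j a)
        else if x j = z j then (1 : ℝ) else 0) = if update x i (z i) = z then 1 else 0 := by
      rw [Finset.prod_congr rfl fun j hj => if_neg (Finset.ne_of_mem_erase hj)]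
      rw [Finset.prod_ite_zero]
      simp only [Finset.prod_const_one]
      refine if_congr ⟨fun h => ?_, fun h j hj => ?_⟩ rfl rfl
      · funext j
        by_cases hj : j = i
        · subst hj
          rw [update_self]
        · rw [update_of_ne hj, h j (Finset.mem_erase.2 ⟨hj, Finset.mem_univ _⟩)]
      · rw [← h, update_of_ne (Finset.ne_of_mem_erase hj)]
    rw [hrest, mul_ite, mul_one, mul_zero]
    refine if_ctx_congr Iff.rfl (fun h => ?_) fun _ => rfl
    have hx : update z i (x i) = x := by
      rw [← h]
      simp
    have hagree : A.AgreeUpTo r z (A.fill (V (A.block z)) z) :=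
      agreeUpTo_fill h1.symm fun t ht => eq_of_pre_eq h1.symm (hz.1.trans h2.symm) ht
    have hexp : ∀ a, Real.exp (θ.input z i a) = A.marginal S p (r + 1) (update z i a) := by
      intro a
      rw [hθ]
      simp only [G]
      rw [Real.exp_log (A.marginal_pos hp hr _), hbl (A.block z)]
      exact (A.marginal_congr hinv hr _ _ (hagree.update_succ a)).symm
    simp only [hexp, hx]
    rw [A.marginal_eq_sum p hr z]

-- States with prefix `w` carry mass only where the current unit is at its default; the kernel
-- spreads this mass along that unit. All other states are copied, and the prefix is unchanged
-- because the units of a block are distinct.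
open Classical in
theorem stage_insert (o : State q) {S r : ℕ} (hr : r < S) (hS : S ≤ A.length)
    {p : State q → ℝ} (hp : ∀ x, 0 < p x) {w : Fin r → ℕ} {W : Finset (Fin r → ℕ)} (hw : w ∉ W)
    {K : State q → State q → ℝ}
    (hK : ∀ x z,
      (¬ (A.pre r z = w ∧ z (A.unit (A.block z) r) = o (A.unit (A.block z) r)) →
        K x z = if z = x then 1 else 0) ∧
      (A.pre r z = w ∧ z (A.unit (A.block z) r) = o (A.unit (A.block z) r) →
        K x z = if update x (A.unit (A.block z) r) (z (A.unit (A.block z) r)) = z then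
          A.marginal S p (r + 1) x / A.marginal S p r z else 0)) (x : State q) :
    ∑ z, K x z * A.stage o S p r W z = A.stage o S p r (insert w W) x := by
  have hrA : r < A.length := hr.trans_le hS
  have hline : ∀ z, A.pre r z = w ∧ z (A.unit (A.block z) r) = o (A.unit (A.block z) r) →
      K x z ≠ 0 →
      A.pre r x = w ∧ z = update x (A.unit (A.block x) r) (o (A.unit (A.block x) r)) := by
    intro z hz hne
    rw [(hK x z).2 hz] at hne
    have h := of_not_not fun h => hne (if_neg h)
    have hb : A.block x = A.block z := by
      have := congrArg A.block h
      rwa [block_update] at this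
    rw [hz.2, ← hb] at h
    refine ⟨?_, h.symm⟩
    rw [← hz.1, ← h, pre_update _ hrA]
  by_cases hx : A.pre r x = w
  · set i := A.unit (A.block x) r with hi
    have hbz : A.block (update x i (o i)) = A.block x := A.block_update x _ _ _
    have hpz : A.pre r (update x i (o i)) = w := by rw [A.pre_update hrA, hx]
    rw [Finset.sum_eq_single (update x i (o i))]
    · rw [(hK _ _).2 ⟨hpz, by rw [hbz]; exact update_self i (o i) x⟩, hbz, ← hi, update_self, if_pos rfl]
      unfold stage
      have hd : A.depth r W (update x i (o i)) = r := by rw [depth, hpz, if_neg hw]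
      have hd' : A.depth r (insert w W) x = r + 1 := by
        rw [depth, hx, if_pos (Finset.mem_insert_self _ _)]
      rw [hd, hd', hbz, mul_ite, mul_zero,
        div_mul_cancel₀ _ (A.marginal_pos hp hr.le _).ne']
      refine if_congr ⟨fun h t ht htS => ?_, fun h t ht htS => ?_⟩ rfl rfl
      · have := h t (by omega) htS
        rwa [update_of_ne] at this
        intro heq
        have := A.unit_injOn _ (htS.trans_le hS) hrA heq
        omega
      · by_cases htr : t = r
        · subst htr
          exact update_self _ _ _
        · rw [update_of_ne]
          · exact h t (by omega) htS
          · intro heq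
            exact htr (A.unit_injOn _ (htS.trans_le hS) hrA heq)
    · intro z _ hne
      by_cases hz : A.pre r z = w ∧ z (A.unit (A.block z) r) = o (A.unit (A.block z) r)
      · by_cases hKz : K x z = 0
        · rw [hKz, zero_mul]
        · exact absurd (hline z hz hKz).2 hne
      · rw [(hK x z).1 hz]
        split_ifs with hzx
        · subst hzx
          unfold stage
          rw [if_neg, mul_zero]
          intro h
          refine hz ⟨hx, h r ?_ hr⟩
          rw [depth, hx, if_neg hw]
        · rw [zero_mul]
    · simp
  · rw [Finset.sum_eq_single x]
    · rw [(hK x x).1 (fun h => hx h.1), if_pos rfl, one_mul]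
      have hd : A.depth r (insert w W) x = A.depth r W x := by
        simp [depth, hx]
      unfold stage
      rw [hd]
    · intro z _ hne
      by_cases hz : A.pre r z = w ∧ z (A.unit (A.block z) r) = o (A.unit (A.block z) r)
      · by_cases hKz : K x z = 0
        · rw [hKz, zero_mul]
        · exact absurd (hline z hz hKz).1 hx
      · rw [(hK x z).1 hz, if_neg hne, zero_mul]
    · simp

theorem stage_mem_closure (o : State q) {S r T : ℕ} (hr : r < S) (hS : S ≤ A.length)
    {p : State q → ℝ} (hp : ∀ x, 0 < p x) (hinv : ∀ x y, A.AgreeUpTo S x y → p x = p y) (c : ℝ)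
    (h : (fun x => c * A.stage o S p r ∅ x) ∈ closure (dbnModel q (T + 2)))
    (W : Finset (Fin r → ℕ)) :
    (fun x => c * A.stage o S p r W x) ∈ closure (dbnModel q (T + W.card + 2)) := by
  classical
  induction W using Finset.induction_on with
  | empty => simpa using h
  | insert w W hw ih =>
    obtain ⟨K, hKmem, hK⟩ := A.exists_share_kernel o hr hp hinv w
    have := apply_mem_closure ih hKmem
    rw [Finset.card_insert_of_notMem hw, ← add_assoc]
    convert this using 2 with x
    rw [← A.stage_insert o hr hS hp hw hK x, Finset.mul_sum]
    exact Finset.sum_congr rfl fun z _ => by ring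

/-- A positive distribution that only depends on the block, the free unit and the units that share
in the first `S` phases is a limit of visible distributions. -/
theorem mem_closure_dbnModel (o : State q) {S Q : ℕ} (hS : S ≤ A.length)
    (hQ : ∀ b t, q (A.unit b t) ≤ Q) {p : State q → ℝ} (hp : ∀ x, 0 < p x)
    (hinv : ∀ x y, A.AgreeUpTo S x y → p x = p y) (hsum : ∑ x, p x = 1) :
    p ∈ closure (dbnModel q (∑ r ∈ Finset.range S, Q ^ r + 2)) := by
  classical
  set c := (∑ y, A.stage o S p 0 ∅ y)⁻¹
  have key : ∀ r ≤ S, (fun x => c * A.stage o S p r ∅ x) ∈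
      closure (dbnModel q (∑ r ∈ Finset.range r, Q ^ r + 2)) := by
    intro r
    induction r with
    | zero => exact fun _ => by simpa using A.stage_zero_mem_closure o hp hinv
    | succ r ih =>
      intro hr
      have h := A.stage_mem_closure o hr hS hp hinv c (ih (by omega))
        -- These `Q ^ r` prefixes include every possible one, so the end of phase `r` is the start
        -- of phase `r + 1`.
        (Fintype.piFinset fun _ => Finset.range Q)
      rw [Fintype.card_piFinset_const, Finset.card_range,
        ← Finset.sum_range_succ] at h
      convert h using 3 with x
      have hd : A.depth r (Fintype.piFinset fun _ => Finset.range Q) x = r + 1 := by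
        rw [depth, if_pos]
        rw [Fintype.mem_piFinset]
        intro t
        exact Finset.mem_range.2 ((x _).2.trans_le (hQ _ _))
      unfold stage
      rw [hd, depth_empty]
  have hfin := key S le_rfl
  have hstage : ∀ x, A.stage o S p S ∅ x = p x := by
    intro x
    unfold stage
    rw [depth_empty, if_pos (fun t ht ht' => absurd ht' (by omega)), marginal_self]
  simp only [hstage] at hfin
  have : Nonempty (State q) := ⟨o⟩
  -- Limits of visible distributions have total mass one, which forces `c = 1`.
  have h1 := sum_eq_one_of_mem_closure hfin
  rw [← Finset.mul_sum, hsum, mul_one] at h1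
  simpa [h1] using hfin

end Scheme

/-! ### Divergence from averaged distributions -/

theorem klDivergence_le_of_le {X : Type*} [Fintype X] {p r : X → ℝ} (hp : p ∈ stdSimplex ℝ X)
    (hr : ∀ x, 0 < r x) {c : ℝ} (h : ∀ x, p x ≤ c * r x) :
    klDivergence p r ≤ ((Real.log c : ℝ) : EReal) := by
  unfold klDivergence
  rw [if_pos (fun x hx => absurd hx (hr x).ne')]
  rw [EReal.coe_le_coe_iff]
  calc ∑ x, p x * Real.log (p x / r x) ≤ ∑ x, p x * Real.log c := by
        refine Finset.sum_le_sum fun x _ => ?_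
        rcases (hp.1 x).eq_or_lt with h0 | h0
        · rw [← h0, zero_mul, zero_mul]
        · refine mul_le_mul_of_nonneg_left ?_ h0.le
          refine Real.log_le_log (div_pos h0 (hr x)) ?_
          rw [div_le_iff₀ (hr x)]
          exact h x
    _ = Real.log c := by rw [← Finset.sum_mul, hp.2, one_mul]

/-- If the closure of a set of positive distributions contains all positive distributions that
are constant on the classes of an equivalence relation with classes of at most `k` elements, then
the divergence from the set is at most `log k`. -/
theorem maxDivergence_le_log_of_setoid {X : Type*} [Fintype X] (M : Set (X → ℝ))
    (hM : ∀ r ∈ M, ∀ x, 0 < r x) (s : Setoid X) {k : ℕ} (hk : ∀ x, Set.ncard {y | s x y} ≤ k)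
    (h : ∀ p : X → ℝ, (∀ x, 0 < p x) → ∑ x, p x = 1 → (∀ x y, s x y → p x = p y) → p ∈ closure M) :
    maxDivergence M ≤ ((Real.log k : ℝ) : EReal) := by
  classical
  unfold maxDivergence
  refine iSup₂_le fun p hp => ?_
  have hX : Nonempty X := by
    by_contra hX
    rw [not_nonempty_iff] at hX
    simpa using hp.2
  let cls : X → Finset X := fun x => Finset.univ.filter fun y => s x y
  have hcls : ∀ x y, s x y → cls x = cls y := by
    intro x y hxy
    ext z
    simp only [cls, Finset.mem_filter, Finset.mem_univ, true_and]
    exact ⟨fun hz => s.trans (s.symm hxy) hz, fun hz => s.trans hxy hz⟩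
  have hmem : ∀ x, x ∈ cls x := fun x => Finset.mem_filter.2 ⟨Finset.mem_univ _, s.refl x⟩
  have hcard : ∀ x, ((cls x).card : ℝ) ≤ k := by
    intro x
    have := hk x
    rw [Set.ncard_eq_toFinset_card'] at this
    simp only [Set.toFinset_ofPred] at this
    exact_mod_cast this
  have hcpos : ∀ x, 0 < ((cls x).card : ℝ) := fun x => by
    exact_mod_cast Finset.card_pos.2 ⟨x, hmem x⟩
  obtain ⟨x₀⟩ := id hX
  have hkpos : (0 : ℝ) < k := (hcpos x₀).trans_le (hcard x₀)
  have hNpos : (0 : ℝ) < Fintype.card X := by exact_mod_cast Fintype.card_pos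
  have key : ∀ η : ℝ, 0 < η → η < 1 →
      divergenceFrom p M ≤ ((Real.log (k / (η * η)) : ℝ) : EReal) := by
    intro η h0 h1
    -- Mixing in the uniform distribution makes the class average `a` positive. One factor `η` pays
    -- for this, another for replacing `a` by a nearby member of `M`.
    let e : X → ℝ := fun x => η * p x + (1 - η) / Fintype.card X
    have he : ∀ x, η * p x < e x := fun x => by
      have : 0 < (1 - η) / Fintype.card X := div_pos (by linarith) hNpos
      simp only [e]
      linarith
    have he0 : ∀ x, 0 < e x := fun x => (mul_nonneg h0.le (hp.1 x)).trans_lt (he x)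
    have hesum : ∑ x, e x = 1 := by
      simp only [e, Finset.sum_add_distrib, ← Finset.mul_sum, hp.2, Finset.sum_const,
        Finset.card_univ, nsmul_eq_mul]
      field_simp
      ring
    let a : X → ℝ := fun x => (∑ y ∈ cls x, e y) / (cls x).card
    have ha : ∀ x, e x / k ≤ a x := by
      intro x
      have h2 : e x ≤ ∑ y ∈ cls x, e y :=
        Finset.single_le_sum (f := e) (fun y _ => (he0 y).le) (hmem x)
      exact div_le_div₀ ((he0 x).le.trans h2) h2 (hcpos x) (hcard x)
    have ha0 : ∀ x, 0 < a x := fun x => (div_pos (he0 x) hkpos).trans_le (ha x)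
    have hasum : ∑ x, a x = 1 := by
      rw [← hesum]
      have ha' : ∀ x, a x = ∑ y, if s x y then e y / ((cls x).card : ℝ) else 0 := fun x => by
        rw [← Finset.sum_filter, ← Finset.sum_div]
      rw [Finset.sum_congr rfl fun x _ => ha' x, Finset.sum_comm]
      refine Finset.sum_congr rfl fun y _ => ?_
      have h3 : ∀ x, (if s x y then e y / ((cls x).card : ℝ) else 0) =
          if s y x then e y / ((cls y).card : ℝ) else 0 := by
        intro x
        by_cases hxy : s x y
        · rw [if_pos hxy, if_pos (s.symm hxy), hcls x y hxy]
        · rw [if_neg hxy, if_neg (fun hyx => hxy (s.symm hyx))]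
      rw [Finset.sum_congr rfl fun x _ => h3 x, ← Finset.sum_filter, Finset.sum_const, nsmul_eq_mul]
      exact mul_div_cancel₀ _ (hcpos y).ne'
    have hacl : a ∈ closure M := h a ha0 hasum fun x y hxy => by simp only [a, hcls x y hxy]
    have hopen : IsOpen {r : X → ℝ | ∀ x, η * a x < r x} := by
      simp only [Set.ofPred_forall]
      exact isOpen_iInter_of_finite fun x => isOpen_lt continuous_const (continuous_apply x)
    obtain ⟨r, hr, hrM⟩ := mem_closure_iff.1 hacl _ hopen fun x => by nlinarith [ha0 x]
    refine (iInf₂_le r hrM).trans (klDivergence_le_of_le hp (hM r hrM) fun x => ?_)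
    have h4 : η * (η * p x / k) ≤ r x := by
      refine le_trans (mul_le_mul_of_nonneg_left ?_ h0.le) (hr x).le
      exact (div_le_div_of_nonneg_right (he x).le hkpos.le).trans (ha x)
    calc p x = k / (η * η) * (η * (η * p x / k)) := by field_simp
      _ ≤ _ := mul_le_mul_of_nonneg_left h4 (by positivity)
  have hlim : Tendsto (fun η : ℝ => ((Real.log (k / (η * η)) : ℝ) : EReal)) (𝓝[<] 1)
      (𝓝 ((Real.log k : ℝ) : EReal)) := by
    refine (continuous_coe_real_ereal.tendsto _).comp ?_
    have hc : ContinuousAt (fun η : ℝ => Real.log (k / (η * η))) 1 := by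
      refine ContinuousAt.log (ContinuousAt.div (by fun_prop) (by fun_prop) (by norm_num)) ?_
      simpa using hkpos.ne'
    have := hc.tendsto
    simp only [mul_one, div_one] at this
    exact this.mono_left nhdsWithin_le_nhds
  refine ge_of_tendsto hlim ?_
  filter_upwards [Ioo_mem_nhdsLT (show (0 : ℝ) < 1 by norm_num)] with η hη
  exact key η hη.1 hη.2

namespace Scheme

variable {β : Type} (A : Scheme q β)

/-- Agreement up to the phase `S` as an equivalence relation. -/
def agreeSetoid (S : ℕ) : Setoid (State q) where
  r := A.AgreeUpTo S
  iseqv := ⟨AgreeUpTo.refl S, AgreeUpTo.symm, AgreeUpTo.trans⟩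

/-- By `cover`, a state in the class is determined by its units of the phases from `S` on. -/
theorem ncard_agreeUpTo_le (S : ℕ) (x : State q) :
    Set.ncard {y | A.AgreeUpTo S x y} ≤
      ∏ t ∈ Finset.Ico S A.length, q (A.unit (A.block x) t) := by
  classical
  let f : State q → ∀ t : Finset.Ico S A.length, Fin (q (A.unit (A.block x) t)) :=
    fun y t => y (A.unit (A.block x) t)
  have hf : Set.InjOn f {y | A.AgreeUpTo S x y} := by
    intro y hy z hz hyz
    funext i
    have hagree : A.AgreeUpTo S y z := hy.symm.trans hz
    rcases A.cover (A.block x) i with hi | hi | ⟨t, ht, rfl⟩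
    · exact hagree i (Or.inl hi)
    · exact hagree i (Or.inr (Or.inl hi))
    · by_cases htS : t < S
      · exact hagree _ (Or.inr (Or.inr ⟨t, htS, by rw [← hy.block_eq]⟩))
      · exact congrFun hyz ⟨t, Finset.mem_Ico.2 ⟨not_lt.1 htS, ht⟩⟩
  calc Set.ncard {y | A.AgreeUpTo S x y} = Set.ncard (f '' {y | A.AgreeUpTo S x y}) :=
        hf.ncard_image.symm
    _ ≤ Nat.card (∀ t : Finset.Ico S A.length, Fin (q (A.unit (A.block x) t))) :=
        Set.ncard_le_card _
    _ = _ := by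
        rw [Nat.card_eq_fintype_card, Fintype.card_pi]
        simp only [Fintype.card_fin]
        exact Finset.prod_coe_sort (Finset.Ico S A.length) fun t => q (A.unit (A.block x) t)

theorem maxDivergence_le (o : State q) {S Q T k : ℕ} (hS : S ≤ A.length)
    (hQ : ∀ b t, q (A.unit b t) ≤ Q) (hT : ∑ r ∈ Finset.range S, Q ^ r ≤ T)
    (hk : ∀ b, ∏ t ∈ Finset.Ico S A.length, q (A.unit b t) ≤ k) :
    maxDivergence (dbnModel q (T + 2)) ≤ ((Real.log k : ℝ) : EReal) := by
  refine maxDivergence_le_log_of_setoid _ ?_ (A.agreeSetoid S)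
    (fun x => (A.ncard_agreeUpTo_le S x).trans (hk _)) fun p hp hsum hinv => ?_
  · rintro _ ⟨T', -, θ, rfl⟩
    exact θ.visible_pos
  · exact closure_dbnModel_mono o hT (A.mem_closure_dbnModel o hS hQ hp hinv hsum)

end Scheme

/-! ### The scheme with cyclically shifted units -/

/-- The largest element of `s` is at least `s.card`, so its factor is at most `q s.card`; remove it
and induct. -/
theorem prod_le_prod_Icc_card {q : ℕ → ℕ} {m : ℕ}
    (hq : ∀ i ∈ Finset.Icc 1 m, ∀ j ∈ Finset.Icc 1 m, i ≤ j → q j ≤ q i) (s : Finset ℕ)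
    (hs : s ⊆ Finset.Icc 1 m) : ∏ j ∈ s, q j ≤ ∏ j ∈ Finset.Icc 1 s.card, q j := by
  induction s using Finset.induction_on_max with
  | empty => simp
  | insert a s ha ih =>
    have hnot : a ∉ s := fun h => (ha a h).false
    have ham := Finset.mem_Icc.1 (hs (Finset.mem_insert_self a s))
    have hcard : s.card ≤ a - 1 := by
      have : s ⊆ Finset.Icc 1 (a - 1) := fun x hx => by
        have h1 := Finset.mem_Icc.1 (hs (Finset.mem_insert_of_mem hx))
        have h2 := ha x hx
        exact Finset.mem_Icc.2 ⟨h1.1, by omega⟩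
      simpa using Finset.card_le_card this
    rw [Finset.prod_insert hnot, Finset.card_insert_of_notMem hnot,
      Finset.prod_Icc_succ_top (by omega), mul_comm]
    refine Nat.mul_le_mul (ih fun x hx => hs (Finset.mem_insert_of_mem hx)) (hq _ ?_ _ ?_ ?_)
    · exact Finset.mem_Icc.2 ⟨by omega, by omega⟩
    · exact Finset.mem_Icc.2 ham
    · omega

/-- The blocks of the cyclic scheme: the states of the units beyond the unit `m`. -/
abbrev TailState (n m : ℕ) (q : ℕ → ℕ) : Type :=
  ∀ i : {i : Fin n // m < i}, Fin (q ((i : ℕ) + 1))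

theorem card_tailState (n m : ℕ) (q : ℕ → ℕ) :
    Fintype.card (TailState n m q) = ∏ j ∈ Finset.Icc (m + 2) n, q j := by
  rw [Fintype.card_pi]
  simp only [Fintype.card_fin]
  refine Finset.prod_bij (fun i _ => (i.1 : ℕ) + 1) ?_ ?_ ?_ ?_
  · rintro ⟨i, hi⟩ -
    have := i.2
    exact Finset.mem_Icc.2 ⟨by simp only; omega, by simp only; omega⟩
  · rintro ⟨i, hi⟩ - ⟨j, hj⟩ - h
    exact Subtype.ext (Fin.ext (Nat.succ_injective h))
  · intro j hj
    obtain ⟨h1, h2⟩ := Finset.mem_Icc.1 hj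
    exact ⟨⟨⟨j - 1, by omega⟩, by simp only; omega⟩, Finset.mem_univ _, by simp only; omega⟩
  · simp

/-- In the phase `t`, the block with number `e b` shares in the unit `e b + t` modulo `m`. -/
def cyclicScheme {n m : ℕ} (q : ℕ → ℕ) (hq : ∀ j ∈ Finset.Icc 1 n, 1 ≤ q j)
    (hq2 : ∀ j ∈ Finset.Icc 1 m, 2 ≤ q j) (hmn : m ≤ n) (hm : 0 < m)
    (e : TailState n m q ↪ Fin m) :
    Scheme (fun i : Fin n => q ((i : ℕ) + 1)) (TailState n m q) where
  block x i := x i.1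
  fixed := Finset.univ.filter fun i => m < i
  free := Finset.univ.filter fun i => (i : ℕ) = m
  unit b t := ⟨(e b + t) % m, (Nat.mod_lt _ hm).trans_le hmn⟩
  length := m
  block_eq_iff := by
    intro x y
    simp [funext_iff]
  block_surjective := fun b => by
    refine ⟨fun i => if h : m < i then b ⟨i, h⟩ else
      ⟨0, hq _ (Finset.mem_Icc.2 ⟨by omega, by omega⟩)⟩, ?_⟩
    funext i
    simp [i.2]
  unit_notMem := fun b t => by
    have := Nat.mod_lt (e b + t) hm
    simp only [Finset.mem_filter, Finset.mem_univ, true_and, not_lt]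
    exact this.le
  unit_injective_block := fun t b b' h => by
    have h1 : (e b : ℕ) + t ≡ e b' + t [MOD m] := by simpa [Nat.ModEq] using h
    exact e.injective (Fin.ext ((Nat.ModEq.add_right_cancel' t h1).eq_of_lt_of_lt (e b).2 (e b').2))
  unit_injOn := fun b t ht t' ht' h => by
    have h1 : (e b : ℕ) + t ≡ e b + t' [MOD m] := by simpa [Nat.ModEq] using h
    exact (Nat.ModEq.add_left_cancel' _ h1).eq_of_lt_of_lt ht ht'
  cover := fun b i => by
    rcases lt_trichotomy (i : ℕ) m with h | h | h
    -- The phase is `i - e b` modulo `m`, with `m` added to avoid truncated subtraction.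
    · refine Or.inr (Or.inr ⟨(i + (m - e b)) % m, Nat.mod_lt _ hm, Fin.ext ?_⟩)
      have hb := (e b).2
      simp only [Nat.add_mod_mod]
      rw [show (e b : ℕ) + (i + (m - e b)) = i + m by omega, Nat.add_mod_right, Nat.mod_eq_of_lt h]
    · exact Or.inr (Or.inl (by simpa using h))
    · exact Or.inl (by simpa using h)
  card_free := by
    refine Finset.card_le_one.2 fun i hi j hj => Fin.ext ?_
    simp only [Finset.mem_filter, Finset.mem_univ, true_and] at hi hj
    rw [hi, hj]
  two_le := fun b t => hq2 _ (Finset.mem_Icc.2 ⟨by omega, Nat.mod_lt _ hm⟩)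

theorem maxDivergence_dbnModel_le (n m S L : ℕ) (q : ℕ → ℕ)
    (hq : ∀ j ∈ Finset.Icc 1 n, 1 ≤ q j) (hq2 : ∀ j ∈ Finset.Icc 1 m, 2 ≤ q j)
    (hprod : ∏ j ∈ Finset.Icc (m + 2) n, q j ≤ m) (hmn : m ≤ n)
    (hanti : ∀ i ∈ Finset.Icc 1 m, ∀ j ∈ Finset.Icc 1 m, i ≤ j → q j ≤ q i) (hS : S ≤ m)
    (hL : (2 : ℝ) + ((q 1 : ℝ) ^ S - 1) / ((q 1 : ℝ) - 1) ≤ (L : ℝ)) :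
    maxDivergence (dbnModel (fun i : Fin n => q ((i : ℕ) + 1)) L)
      ≤ ((Real.log (∏ j ∈ Finset.Icc 1 (m - S), (q j : ℝ)) : ℝ) : EReal) := by
  classical
  have hm : 0 < m := by
    refine lt_of_lt_of_le (Finset.prod_pos fun j hj => ?_) hprod
    obtain ⟨h1, h2⟩ := Finset.mem_Icc.1 hj
    exact hq j (Finset.mem_Icc.2 ⟨by omega, h2⟩)
  obtain ⟨e⟩ : Nonempty (TailState n m q ↪ Fin m) :=
    Function.Embedding.nonempty_of_card_le (by rwa [card_tailState, Fintype.card_fin])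
  have hunit : ∀ b t, q ((e b + t) % m + 1) ≤ q 1 := fun b t =>
    hanti 1 (Finset.mem_Icc.2 ⟨le_rfl, hm⟩) _
      (Finset.mem_Icc.2 ⟨by omega, Nat.mod_lt _ hm⟩) (by omega)
  have hq1 : (q 1 : ℝ) ≠ 1 := by
    have := hq2 1 (Finset.mem_Icc.2 ⟨le_rfl, hm⟩)
    exact_mod_cast (show q 1 ≠ 1 by omega)
  rw [← geom_sum_eq hq1] at hL
  have hL' : 2 + ∑ r ∈ Finset.range S, q 1 ^ r ≤ L := by exact_mod_cast hL
  obtain ⟨T, rfl⟩ : ∃ T, L = T + 2 := ⟨L - 2, by omega⟩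
  have := (cyclicScheme q hq hq2 hmn hm e).maxDivergence_le
    (fun i => ⟨0, hq _ (Finset.mem_Icc.2 ⟨by omega, by omega⟩)⟩) (S := S) (Q := q 1) (T := T)
    (k := ∏ j ∈ Finset.Icc 1 (m - S), q j) hS hunit (by omega) fun b => ?_
  · rwa [Nat.cast_prod] at this
  · have hinj : Set.InjOn (fun t => (e b + t) % m + 1) (Finset.Ico S m : Set ℕ) := by
      intro t ht t' ht' h
      simp only [Finset.coe_Ico, Set.mem_Ico] at ht ht'
      exact (Nat.ModEq.add_left_cancel' (e b : ℕ) (Nat.succ_injective h)).eq_of_lt_of_lt ht.2 ht'.2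
    have h := prod_le_prod_Icc_card hanti ((Finset.Ico S m).image fun t => (e b + t) % m + 1)
      fun j hj => by
        obtain ⟨t, -, rfl⟩ := Finset.mem_image.1 hj
        exact Finset.mem_Icc.2 ⟨by omega, Nat.mod_lt _ hm⟩
    rw [Finset.prod_image hinj, Finset.card_image_of_injOn hinj, Nat.card_Ico] at h
    exact h

end DeepBelief
end

theorem mainTheorem1 :
    (∀ (n m S L : ℕ) (q : ℕ → ℕ),
      (∀ j ∈ Finset.Icc 1 n, 1 ≤ q j) →
      (∀ j ∈ Finset.Icc 1 m, 2 ≤ q j) →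
      ∏ j ∈ Finset.Icc (m + 2) n, q j ≤ m →
      m ≤ n →
      (∀ i ∈ Finset.Icc 1 m, ∀ j ∈ Finset.Icc 1 m, i ≤ j → q j ≤ q i) →
      S ≤ m →
      (2 : ℝ) + ((q 1 : ℝ) ^ S - 1) / ((q 1 : ℝ) - 1) ≤ (L : ℝ) →
      DeepBelief.maxDivergence (DeepBelief.dbnModel (fun i : Fin n => q ((i : ℕ) + 1)) L)
        ≤ ((Real.log (∏ j ∈ Finset.Icc 1 (m - S), (q j : ℝ)) : ℝ) : EReal)) ∧
    (∀ (k S L : ℕ),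
      1 ≤ k →
      S ≤ 2 ^ (k - 1) →
      1 + 2 ^ S ≤ L →
      DeepBelief.maxDivergence (DeepBelief.dbnModel (fun _ : Fin (2 ^ (k - 1) + k) => 2) L)
        ≤ ((((2 : ℝ) ^ (k - 1) - (S : ℝ)) * Real.log 2 : ℝ) : EReal)) := by
  refine ⟨DeepBelief.maxDivergence_dbnModel_le, fun k S L hk hS hL => ?_⟩
  have h := DeepBelief.maxDivergence_dbnModel_le (2 ^ (k - 1) + k) (2 ^ (k - 1)) S L (fun _ => 2)
    (fun _ _ => by norm_num) (fun _ _ => le_rfl) ?_ (by omega) (fun _ _ _ _ _ => le_rfl) hS ?_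
  · simpa [Real.log_pow, Nat.cast_sub hS] using h
  -- Beyond the sharing units and the free unit there are `k - 1` binary units, hence exactly `2 ^
  -- (k - 1) = m` blocks.
  · rw [Finset.prod_const, Nat.card_Icc]
    exact Nat.pow_le_pow_right (by norm_num) (by omega)
  · have : (1 : ℝ) + 2 ^ S ≤ L := by exact_mod_cast hL
    norm_num
    linarith
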